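/- Let $A:\mathbb R\to\mathbb C$ be the unique solution of $$A''(y)+2yA(y)=0,\qquad A(0)=\Gamma(1/3)\,6^{-2/3}(3+i\sqrt3),\qquad A'(0)=\Gamma(2/3)\,6^{-1/3}(-3+i\sqrt3),$$ and for $\nu>0$ and $|\beta|<\pi/2$ put $$b(\nu,\beta)=e^{-i\nu(\tan^3\beta)/3}\,\nu^{-1/3}A\!\left(\tfrac12\nu^{2/3}\tan^2\beta\right).$$ Write $f\lesssim g$ if $f\le Cg$ for an absolute constant $C$ (independent of $y,\nu,\beta$), and $f\approx g$ if $f\lesssim g$ and $g\lesssim f$. For all $y\ge 0$, $$|A(y)|\approx(1+y)^{-1/4},\qquad |A'(y)|\approx(1+y)^{1/4}.$$ For all $\nu\ge 1/2$ and $0\le\beta\le\pi/4$, the function $b$ is differentiable in $\nu$ and in $\beta$, and a) $|b|\approx \nu^{-1/3}$ if $\beta\le\nu^{-1/3}$, and $|b|\approx\nu^{-1/2}\beta^{-1/2}$ if $\beta\ge\nu^{-1/3}$; b) $|\partial_\nu b|\lesssim \nu^{-4/3}$ if $\beta\le\nu^{-1/3}$, and $|\partial_\nu b|\lesssim\nu^{-1/2}\beta^{5/2}$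 if $\beta\ge\nu^{-1/3}$; c) $|\partial_\beta b|\lesssim \nu^{1/3}\beta$ if $\beta\le\nu^{-1/3}$, and $|\partial_\beta b|\lesssim\nu^{1/2}\beta^{3/2}$ if $\beta\ge\nu^{-1/3}$. -/

import Mathlib

/-- `A` is a solution on `ℝ` of the initial value problem
`A'' + 2 y A = 0`,
`A(0) = Γ(1/3) 6^(-2/3) (3 + i √3)`, `A'(0) = Γ(2/3) 6^(-1/3) (-3 + i √3)`. -/
structure IsAirySolution (A : ℝ → ℂ) : Prop where
  differentiable : Differentiable ℝ A
  differentiable_deriv : Differentiable ℝ (deriv A)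
  equation : ∀ y : ℝ, deriv (deriv A) y + 2 * (y : ℂ) * A y = 0
  value_zero : A 0 =
    ((Real.Gamma (1 / 3) * (6 : ℝ) ^ (-(2 / 3) : ℝ) : ℝ) : ℂ) *
      (3 + Complex.I * ((Real.sqrt 3 : ℝ) : ℂ))
  deriv_zero : deriv A 0 =
    ((Real.Gamma (2 / 3) * (6 : ℝ) ^ (-(1 / 3) : ℝ) : ℝ) : ℂ) *
      (-3 + Complex.I * ((Real.sqrt 3 : ℝ) : ℂ))

/-- Term-by-term differentiation of an everywhere convergent power series. -/
theorem hasDerivAt_tsum_of_entire (c : ℕ → ℂ)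
    (hc : ∀ R : ℝ, 0 ≤ R → ∃ M : ℝ, ∀ n, ‖c n‖ * R ^ n ≤ M) (z : ℂ) :
    HasDerivAt (fun w : ℂ => ∑' n, c n * w ^ n)
      (∑' n : ℕ, ((n + 1 : ℕ) : ℂ) * c (n + 1) * z ^ n) z := by
  set r : ℝ := ‖z‖ + 1 with hr
  have hr1 : 1 ≤ r := by have := norm_nonneg z; linarith
  obtain ⟨M, hM⟩ := hc (2 * r) (by linarith)
  have hsum : Summable (fun n : ℕ => M * ((n : ℝ) ^ 1 * (1 / 2 : ℝ) ^ n)) :=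
    (summable_pow_mul_geometric_of_norm_lt_one (R := ℝ) 1 (r := 1 / 2) (by norm_num)).mul_left M
  have hb : ∀ n (w : ℂ), w ∈ Metric.ball (0 : ℂ) r →
      ‖c n * ((n : ℂ) * w ^ (n - 1))‖ ≤ M * ((n : ℝ) ^ 1 * (1 / 2 : ℝ) ^ n) := by
    intro n w hw
    have hw' : ‖w‖ ≤ r := by simpa using (le_of_lt (mem_ball_zero_iff.1 hw))
    have h1 : ‖w‖ ^ (n - 1) ≤ r ^ n :=
      (pow_le_pow_left₀ (norm_nonneg _) hw' _).trans (pow_le_pow_right₀ hr1 (Nat.sub_le _ _))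
    have h2 : ‖c n‖ * r ^ n ≤ M * (1 / 2 : ℝ) ^ n := by
      have := hM n
      rw [mul_pow] at this
      have h3 : ‖c n‖ * r ^ n = (‖c n‖ * (2 ^ n * r ^ n)) * (1 / 2 : ℝ) ^ n := by
        rw [one_div, inv_pow]; field_simp
      rw [h3]
      gcongr
    rw [norm_mul, norm_mul, norm_pow, Complex.norm_natCast, pow_one]
    calc ‖c n‖ * ((n : ℝ) * ‖w‖ ^ (n - 1)) = n * (‖c n‖ * ‖w‖ ^ (n - 1)) := by ring
      _ ≤ n * (‖c n‖ * r ^ n) := by gcongr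
      _ ≤ n * (M * (1 / 2 : ℝ) ^ n) := by gcongr
      _ = _ := by ring
  have hz : z ∈ Metric.ball (0 : ℂ) r := by simp [hr]
  have key := hasDerivAt_tsum_of_isPreconnected (𝕜 := ℂ) (g := fun n w => c n * w ^ n)
    (g' := fun n w => c n * ((n : ℂ) * w ^ (n - 1))) (y₀ := 0) hsum Metric.isOpen_ball
    (convex_ball (0 : ℂ) r).isPreconnected
    (fun n w _ => (hasDerivAt_pow n w).const_mul (c n)) hb
    (by simp; linarith)
    (summable_of_ne_finset_zero (s := {0}) (by
      intro n hn; simp at hn; simp [hn])) hz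
  have hs : Summable (fun n : ℕ => c n * ((n : ℂ) * z ^ (n - 1))) :=
    Summable.of_norm_bounded hsum (fun n => hb n z hz)
  suffices e : ∑' n : ℕ, ((n + 1 : ℕ) : ℂ) * c (n + 1) * z ^ n =
      ∑' n : ℕ, c n * ((n : ℂ) * z ^ (n - 1)) by
    rw [e]; exact key
  rw [hs.tsum_eq_zero_add]
  simp only [Nat.cast_zero, zero_mul, mul_zero, zero_add]
  refine tsum_congr fun n => ?_
  simp only [Nat.add_sub_cancel]
  ring

/-- Power series coefficients of the solution of `A'' + 2 y A = 0`, `A(0) = p`, `A'(0) = q`. -/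
noncomputable def airyCoeff (p q : ℂ) : ℕ → ℂ
  | 0 => p
  | 1 => q
  | 2 => 0
  | (n + 3) => -2 * airyCoeff p q n / (((n + 2 : ℕ) : ℂ) * ((n + 3 : ℕ) : ℂ))

theorem airyCoeff_bound (p q : ℂ) (R : ℝ) (hR : 0 ≤ R) :
    ∃ M : ℝ, ∀ n, ‖airyCoeff p q n‖ * R ^ n ≤ M := by
  obtain ⟨N, hN⟩ := exists_nat_ge (2 * R ^ 3)
  refine ⟨∑ i ∈ Finset.range (N + 3), ‖airyCoeff p q i‖ * R ^ i, ?_⟩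
  intro n
  induction n using Nat.strong_induction_on with
  | _ n ih =>
    by_cases hn : n < N + 3
    · exact Finset.single_le_sum (f := fun i => ‖airyCoeff p q i‖ * R ^ i)
        (fun i _ => by positivity) (Finset.mem_range.2 hn)
    · obtain ⟨m, rfl⟩ : ∃ m, n = m + 3 := ⟨n - 3, by omega⟩
      refine le_trans ?_ (ih m (by omega))
      have hm : (N : ℝ) ≤ m := by exact_mod_cast (by omega : N ≤ m)
      have h0 : (0 : ℝ) ≤ m := Nat.cast_nonneg m
      have h1 : 2 * R ^ 3 ≤ ((m : ℝ) + 2) * (m + 3) := by nlinarith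
      have h2 : ‖airyCoeff p q (m + 3)‖ =
          2 * ‖airyCoeff p q m‖ / (((m : ℝ) + 2) * (m + 3)) := by
        rw [airyCoeff, norm_div, norm_mul, norm_mul, Complex.norm_natCast, Complex.norm_natCast]
        simp
      rw [h2, pow_add, div_mul_eq_mul_div, div_le_iff₀ (by positivity)]
      calc 2 * ‖airyCoeff p q m‖ * (R ^ m * R ^ 3)
          = (‖airyCoeff p q m‖ * R ^ m) * (2 * R ^ 3) := by ring
        _ ≤ _ := by gcongr

/-- The initial value problem has a solution. -/
theorem IsAirySolution.exists : ∃ A : ℝ → ℂ, IsAirySolution A := by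
  set p : ℂ := ((Real.Gamma (1 / 3) * (6 : ℝ) ^ (-(2 / 3) : ℝ) : ℝ) : ℂ) *
      (3 + Complex.I * ((Real.sqrt 3 : ℝ) : ℂ)) with hp
  set q : ℂ := ((Real.Gamma (2 / 3) * (6 : ℝ) ^ (-(1 / 3) : ℝ) : ℝ) : ℂ) *
      (-3 + Complex.I * ((Real.sqrt 3 : ℝ) : ℂ)) with hq
  set c := airyCoeff p q with hcdef
  have hc := airyCoeff_bound p q
  rw [← hcdef] at hc
  set d : ℕ → ℂ := fun n => ((n + 1 : ℕ) : ℂ) * c (n + 1) with hd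
  have hdb : ∀ R : ℝ, 0 ≤ R → ∃ M : ℝ, ∀ n, ‖d n‖ * R ^ n ≤ M := by
    intro R hR
    obtain ⟨M, hM⟩ := hc (2 * (R + 1)) (by linarith)
    refine ⟨M, fun n => le_trans ?_ (hM (n + 1))⟩
    have e : ‖d n‖ = ((n + 1 : ℕ) : ℝ) * ‖c (n + 1)‖ := by
      rw [hd]; simp only [norm_mul, Complex.norm_natCast]
    have h2 : ((n + 1 : ℕ) : ℝ) ≤ 2 ^ (n + 1) := by
      exact_mod_cast (Nat.lt_two_pow_self (n := n + 1)).le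
    have h3 : R ^ n ≤ (R + 1) ^ (n + 1) :=
      (pow_le_pow_left₀ hR (by linarith) n).trans
        (pow_le_pow_right₀ (by linarith) (Nat.le_succ n))
    rw [e, mul_pow]
    calc ((n + 1 : ℕ) : ℝ) * ‖c (n + 1)‖ * R ^ n
        = ‖c (n + 1)‖ * (((n + 1 : ℕ) : ℝ) * R ^ n) := by ring
      _ ≤ _ := by gcongr
  have hA : ∀ y : ℝ, HasDerivAt (fun y : ℝ => ∑' n, c n * (y : ℂ) ^ n)
      (∑' n, d n * (y : ℂ) ^ n) y :=
    fun y => (hasDerivAt_tsum_of_entire c hc (y : ℂ)).comp_ofReal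
  have hA' : deriv (fun y : ℝ => ∑' n, c n * (y : ℂ) ^ n) =
      fun y : ℝ => ∑' n, d n * (y : ℂ) ^ n := funext fun y => (hA y).deriv
  have hB : ∀ y : ℝ, HasDerivAt (fun y : ℝ => ∑' n, d n * (y : ℂ) ^ n)
      (∑' n : ℕ, ((n + 1 : ℕ) : ℂ) * d (n + 1) * (y : ℂ) ^ n) y :=
    fun y => (hasDerivAt_tsum_of_entire d hdb (y : ℂ)).comp_ofReal
  have hzero : ∀ e : ℕ → ℂ, ∑' n, e n * ((0 : ℝ) : ℂ) ^ n = e 0 := by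
    intro e
    rw [tsum_eq_single 0]
    · simp
    · intro n hn; simp [hn]
  have hsum : ∀ y : ℂ, Summable (fun n => c n * y ^ n) := by
    intro y
    obtain ⟨M, hM⟩ := hc (2 * ‖y‖) (by positivity)
    refine Summable.of_norm_bounded (g := fun n => M * (1 / 2 : ℝ) ^ n)
      ((summable_geometric_of_lt_one (by norm_num) (by norm_num)).mul_left M) fun n => ?_
    have h := hM n
    have h3 : ‖c n * y ^ n‖ = (‖c n‖ * (2 * ‖y‖) ^ n) * (1 / 2 : ℝ) ^ n := by
      rw [norm_mul, norm_pow, mul_assoc, ← mul_pow]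
      congr 2
      ring
    rw [h3]
    gcongr
  refine ⟨fun y : ℝ => ∑' n, c n * (y : ℂ) ^ n, fun y => (hA y).differentiableAt, ?_, ?_, ?_, ?_⟩
  · rw [hA']; exact fun y => (hB y).differentiableAt
  · intro y
    rw [hA', (hB y).deriv]
    have hcoef : ∀ n : ℕ, ((n + 1 + 1 : ℕ) : ℂ) * d (n + 1 + 1) = -2 * c n := by
      intro n
      have h2 : ((n + 2 : ℕ) : ℂ) ≠ 0 := Nat.cast_ne_zero.2 (by omega)
      have h3 : ((n + 3 : ℕ) : ℂ) ≠ 0 := Nat.cast_ne_zero.2 (by omega)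
      have : d (n + 1 + 1) = ((n + 3 : ℕ) : ℂ) * c (n + 3) := rfl
      rw [this, hcdef, airyCoeff]
      field_simp
    have hsd : ∀ n : ℕ, ((n + 1 + 1 : ℕ) : ℂ) * d (n + 1 + 1) * (y : ℂ) ^ (n + 1) =
        (-2 * y) * (c n * (y : ℂ) ^ n) := by
      intro n; rw [hcoef]; ring
    have hS : Summable (fun n : ℕ => ((n + 1 : ℕ) : ℂ) * d (n + 1) * (y : ℂ) ^ n) := by
      rw [← summable_nat_add_iff 1]
      simp_rw [hsd]
      exact (hsum y).mul_left _
    rw [hS.tsum_eq_zero_add]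
    simp_rw [hsd]
    rw [tsum_mul_left]
    have h0 : d (0 + 1) = 0 := by
      have : d (0 + 1) = ((2 : ℕ) : ℂ) * c 2 := rfl
      rw [this, hcdef]; simp [airyCoeff]
    rw [h0]
    ring
  · simp only [hzero]
    rw [hcdef, airyCoeff]
  · rw [hA']
    simp only [hzero]
    have : d 0 = ((0 + 1 : ℕ) : ℂ) * c 1 := rfl
    rw [this, hcdef, airyCoeff]
    rw [Nat.cast_add, Nat.cast_zero, Nat.cast_one, zero_add, one_mul]

/-- The initial value problem has at most one solution. -/
theorem IsAirySolution.unique {A B : ℝ → ℂ} (hA : IsAirySolution A) (hB : IsAirySolution B) :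
    A = B := by
  funext t
  set T : ℝ := |t| + 1 with hT
  have hT0 : 0 < T := by positivity
  let v : ℝ → ℂ × ℂ → ℂ × ℂ := fun s x => (x.2, -(2 * (s : ℂ) * x.1))
  have hv : ∀ s ∈ Set.Ioo (-T) T,
      LipschitzOnWith (Real.toNNReal (1 + 2 * T)) (v s) Set.univ := by
    intro s hs
    refine LipschitzOnWith.of_dist_le_mul fun x _ y _ => ?_
    rw [Real.coe_toNNReal _ (by positivity), Prod.dist_eq, Prod.dist_eq]
    have hs' : |s| ≤ T := abs_le.2 ⟨hs.1.le, hs.2.le⟩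
    set m := max (dist x.1 y.1) (dist x.2 y.2) with hm
    have hm0 : 0 ≤ m := le_trans dist_nonneg (le_max_left _ _)
    refine max_le ?_ ?_
    · calc dist x.2 y.2 ≤ m := le_max_right _ _
        _ ≤ (1 + 2 * T) * m := by nlinarith
    · have h1 : dist (-(2 * (s : ℂ) * x.1)) (-(2 * (s : ℂ) * y.1)) = 2 * |s| * dist x.1 y.1 := by
        rw [dist_neg_neg, dist_eq_norm, dist_eq_norm, ← mul_sub, norm_mul, norm_mul,
          Complex.norm_real, Real.norm_eq_abs]
        simp
      calc dist (v s x).2 (v s y).2 = 2 * |s| * dist x.1 y.1 := h1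
        _ ≤ 2 * T * m := by gcongr; exact le_max_left _ _
        _ ≤ (1 + 2 * T) * m := by nlinarith
  have hsol : ∀ {F : ℝ → ℂ}, IsAirySolution F → ∀ s ∈ Set.Ioo (-T) T,
      HasDerivAt (fun r => (F r, deriv F r)) (v s (F s, deriv F s)) s ∧
        (F s, deriv F s) ∈ (Set.univ : Set (ℂ × ℂ)) := by
    intro F hF s _
    refine ⟨?_, Set.mem_univ _⟩
    have h2 := (hF.differentiable_deriv s).hasDerivAt
    rw [eq_neg_of_add_eq_zero_left (hF.equation s)] at h2
    exact (hF.differentiable s).hasDerivAt.prodMk h2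
  have h := ODE_solution_unique_of_mem_Ioo (t₀ := 0) hv ⟨by linarith, hT0⟩ (hsol hA) (hsol hB)
    (by simp only [hA.value_zero, hB.value_zero, hA.deriv_zero, hB.deriv_zero])
  have ht : t ∈ Set.Ioo (-T) T := by
    rw [Set.mem_Ioo, ← abs_lt]; linarith
  exact congrArg Prod.fst (h ht)

/-- The Airy-type function `A`: the solution of the initial value problem `IsAirySolution`. -/
noncomputable def airyA : ℝ → ℂ := IsAirySolution.exists.choose

theorem isAirySolution_airyA : IsAirySolution airyA := IsAirySolution.exists.choose_spec

/-- The comparison function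
`b(ν, β) = exp(-i ν tan³β / 3) ν^(-1/3) A(y)` with `y = (1/2) ν^(2/3) tan²β`. -/
noncomputable def airyB (ν β : ℝ) : ℂ :=
  Complex.exp (-Complex.I * (ν : ℂ) * ((Real.tan β : ℝ) : ℂ) ^ 3 / 3) *
    ((ν ^ (-(1 / 3) : ℝ) : ℝ) : ℂ) *
    airyA ((1 / 2) * ν ^ ((2 / 3) : ℝ) * Real.tan β ^ 2)

/-! The estimates for `b` follow from those for `A` by the product rule, so the content is the size
of `A` and `A'`. Upper bounds come from an energy argument. For a real solution, `E = v²/√y + √y u²`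
is the natural WKB quantity, and a modified form of it is shown to be almost monotone
(`airyReal_bound_of_one_le`); compactness covers `[0, 1]`. This is applied to the real and imaginary
parts of `A`. Lower bounds come from the Wronskian of these two parts. It is constant and nonzero at
`0`, and it is at most `‖A‖ ‖A'‖`, so an upper bound on either factor forces the matching lower
bound on the other. For `b`, put `n = ν^(1/3)`. The phase is unimodular and the argument of `A` is
comparable to `(nβ)²`, hence bounded when `nβ ≤ 1`, while `(1 + y)^(1/4)` is comparable to
`(nβ)^(1/2)` when `nβ ≥ 1`. -/

/-! ### Size of `A` and `A'` -/

/-- Boundedness of the weighted energy of a real solution of `u'' + 2 y u = 0` on `[1, ∞)`. -/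
theorem airyReal_bound_of_one_le {u v : ℝ → ℝ} (hu : ∀ y, HasDerivAt u (v y) y)
    (hv : ∀ y, HasDerivAt v (-(2 * y * u y)) y) :
    ∃ K : ℝ, ∀ y, 1 ≤ y → v y ^ 2 / √y + √y * u y ^ 2 ≤ K := by
  -- The first two terms alone have derivative `u²/√y - v²/(2√y³)`, of size `E/y`, which is not
  -- integrable. The corrector `uv/(2√y³)` cancels it exactly, leaving `G' = -(3/4) uv/√y⁵`.
  set G : ℝ → ℝ := fun y => v y ^ 2 / √y + 2 * √y * u y ^ 2 + u y * v y / (2 * √y ^ 3) with hG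
  have hlow : ∀ y, 1 ≤ y → 3 / 4 * (v y ^ 2 / √y + √y * u y ^ 2) ≤ G y ∧
      |u y * v y| ≤ 1 / 2 * (v y ^ 2 / √y + √y * u y ^ 2) := by
    intro y hy
    have hr : 1 ≤ √y := Real.one_le_sqrt.2 hy
    have hr0 : 0 < √y := by linarith
    set r := √y
    have e1 : 2 * |u y * v y| ≤ v y ^ 2 / r + r * u y ^ 2 := by
      have : v y ^ 2 / r + r * u y ^ 2 - 2 * |u y * v y| = (|v y| - r * |u y|) ^ 2 / r := by
        rw [abs_mul]; field_simp
        rw [← sq_abs (v y), ← sq_abs (u y)]; ring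
      have h2 : 0 ≤ (|v y| - r * |u y|) ^ 2 / r := by positivity
      linarith
    have e2 : |u y * v y / (2 * r ^ 3)| ≤ |u y * v y| / 2 := by
      rw [abs_div, abs_of_pos (by positivity : 0 < 2 * r ^ 3)]
      have : (1 : ℝ) ≤ r ^ 3 := one_le_pow₀ hr
      gcongr
      linarith
    have e3 := neg_abs_le (u y * v y / (2 * r ^ 3))
    have e4 : 0 ≤ r * u y ^ 2 := by positivity
    refine ⟨?_, by linarith⟩
    simp only [hG]
    linarith
  -- The integrating factor `exp(y^(-3/2))` contributes `-(3/2) G/√y⁵`. This dominates the remaining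
  -- error, since `(3/4)|uv| ≤ (3/8) E` and `(3/2) G ≥ (9/8) E`.
  have hder : ∀ y, 1 ≤ y → HasDerivAt (fun y => G y * Real.exp (1 / √y ^ 3))
      ((-(3 / 4) * (u y * v y) / √y ^ 5 - 3 / 2 * G y / √y ^ 5) * Real.exp (1 / √y ^ 3)) y := by
    intro y hy
    have hy0 : y ≠ 0 := by linarith
    have hr0 : √y ≠ 0 := (Real.sqrt_pos.2 (by linarith)).ne'
    have hs := Real.hasDerivAt_sqrt hy0
    have hyr : y = √y ^ 2 := (Real.sq_sqrt (by linarith)).symm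
    have h1 := ((((hv y).pow 2).div hs hr0).add ((hs.const_mul 2).mul ((hu y).pow 2))).add
      (((hu y).mul (hv y)).div ((hs.pow 3).const_mul 2) (mul_ne_zero two_ne_zero (pow_ne_zero 3 hr0)))
    have h2 := ((hasDerivAt_const y (1 : ℝ)).div (hs.pow 3) (pow_ne_zero 3 hr0)).exp
    refine (h1.mul h2).congr_deriv ?_
    simp only [hG, Pi.add_apply, Pi.mul_apply, Pi.div_apply, Pi.pow_apply]
    generalize √y = r at *
    generalize u y = a
    generalize v y = b
    subst hyr
    generalize Real.exp _ = e
    field_simp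
    push_cast
    ring
  have hanti : AntitoneOn (fun y => G y * Real.exp (1 / √y ^ 3)) (Set.Ici 1) := by
    refine antitoneOn_of_deriv_nonpos (convex_Ici 1)
      (fun y hy => (hder y hy).continuousAt.continuousWithinAt) ?_ ?_
    · rw [interior_Ici]
      exact fun y hy => (hder y (le_of_lt hy)).differentiableAt.differentiableWithinAt
    · rw [interior_Ici]
      intro y hy
      have hy' : 1 ≤ y := le_of_lt hy
      rw [(hder y hy').deriv]
      obtain ⟨h1, h2⟩ := hlow y hy'
      have h3 := neg_abs_le (u y * v y)
      refine mul_nonpos_of_nonpos_of_nonneg ?_ (Real.exp_pos _).le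
      rw [← sub_div]
      exact div_nonpos_of_nonpos_of_nonneg (by linarith [abs_nonneg (u y * v y)]) (by positivity)
  refine ⟨4 / 3 * (G 1 * Real.exp (1 / √1 ^ 3)), fun y hy => ?_⟩
  have h := hanti (Set.mem_Ici.2 le_rfl) (Set.mem_Ici.2 hy) hy
  obtain ⟨h1, h2⟩ := hlow y hy
  have h3 : 1 ≤ Real.exp (1 / √y ^ 3) := Real.one_le_exp (by positivity)
  have h4 : 0 ≤ G y := by linarith [abs_nonneg (u y * v y)]
  simp only at h
  nlinarith

/-- Decay of a real solution of `u'' + 2 y u = 0` and growth of its derivative. -/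
theorem airyReal_bound {u v : ℝ → ℝ} (hu : ∀ y, HasDerivAt u (v y) y)
    (hv : ∀ y, HasDerivAt v (-(2 * y * u y)) y) :
    ∃ K : ℝ, ∀ y, 0 ≤ y → u y ^ 2 * √(1 + y) ≤ K ∧ v y ^ 2 ≤ K * √(1 + y) := by
  obtain ⟨K, hK⟩ := airyReal_bound_of_one_le hu hv
  have hcu : Continuous u := continuous_iff_continuousAt.2 fun y => (hu y).continuousAt
  have hcv : Continuous v := continuous_iff_continuousAt.2 fun y => (hv y).continuousAt
  obtain ⟨M, hM⟩ := (isCompact_Icc (a := (0 : ℝ)) (b := 1)).bddAbove_image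
    (f := fun y => u y ^ 2 * √(1 + y) + v y ^ 2) (by fun_prop)
  -- `M` handles `[0, 1]`; the factor `2` pays for `√(1 + y) ≤ 2√y` on `[1, ∞)`.
  refine ⟨max (2 * K) M, fun y hy => ?_⟩
  have hs1 : 1 ≤ √(1 + y) := Real.one_le_sqrt.2 (by linarith)
  rcases le_total y 1 with h | h
  · have h1 : u y ^ 2 * √(1 + y) + v y ^ 2 ≤ M := hM ⟨y, ⟨hy, h⟩, rfl⟩
    have h2 : 0 ≤ u y ^ 2 * √(1 + y) := by positivity
    have h3 := le_max_right (2 * K) M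
    exact ⟨by nlinarith [sq_nonneg (v y)], by nlinarith [sq_nonneg (v y)]⟩
  · have h1 := hK y h
    have hr1 : 1 ≤ √y := Real.one_le_sqrt.2 h
    have hr : 0 < √y := by linarith
    have h2 : √(1 + y) ≤ 2 * √y := by
      rw [Real.sqrt_le_left (by positivity), mul_pow, Real.sq_sqrt hy]; linarith
    have h2' : √y ≤ √(1 + y) := Real.sqrt_le_sqrt (by linarith)
    have h3 : 0 ≤ v y ^ 2 / √y := by positivity
    have h4 : 0 ≤ √y * u y ^ 2 := by positivity
    have h5 := le_max_left (2 * K) M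
    constructor
    · nlinarith [sq_nonneg (u y)]
    · have h6 : v y ^ 2 ≤ K * √y := by
        rw [← div_le_iff₀ hr]; linarith
      calc v y ^ 2 ≤ K * √y := h6
        _ ≤ max (2 * K) M * √(1 + y) := by gcongr <;> linarith

/-- Two-sided bounds for the Airy-type function and its derivative, with `s ^ 4 = 1 + y`. -/
theorem exists_airyA_bounds : ∃ c C : ℝ, 0 < c ∧ 0 < C ∧ ∀ y s : ℝ, 0 ≤ y → 0 < s → s ^ 4 = 1 + y →
    c / s ≤ ‖airyA y‖ ∧ ‖airyA y‖ ≤ C / s ∧ c * s ≤ ‖deriv airyA y‖ ∧ ‖deriv airyA y‖ ≤ C * s := by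
  have hA := isAirySolution_airyA
  have h1 : ∀ y, HasDerivAt airyA (deriv airyA y) y := fun y => (hA.differentiable y).hasDerivAt
  have h2 : ∀ y : ℝ, HasDerivAt (deriv airyA) (-(2 * (y : ℂ) * airyA y)) y := fun y => by
    have h := (hA.differentiable_deriv y).hasDerivAt
    rwa [eq_neg_of_add_eq_zero_left (hA.equation y)] at h
  have hre1 : ∀ y, HasDerivAt (fun y => (airyA y).re) ((deriv airyA y).re) y := fun y =>
    Complex.reCLM.hasFDerivAt.comp_hasDerivAt y (h1 y)
  have him1 : ∀ y, HasDerivAt (fun y => (airyA y).im) ((deriv airyA y).im) y := fun y =>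
    Complex.imCLM.hasFDerivAt.comp_hasDerivAt y (h1 y)
  have hre2 : ∀ y, HasDerivAt (fun y => (deriv airyA y).re) (-(2 * y * (airyA y).re)) y := fun y =>
    (Complex.reCLM.hasFDerivAt.comp_hasDerivAt y (h2 y)).congr_deriv (by simp)
  have him2 : ∀ y, HasDerivAt (fun y => (deriv airyA y).im) (-(2 * y * (airyA y).im)) y := fun y =>
    (Complex.imCLM.hasFDerivAt.comp_hasDerivAt y (h2 y)).congr_deriv (by simp)
  obtain ⟨K, hK⟩ := airyReal_bound hre1 hre2
  obtain ⟨L, hL⟩ := airyReal_bound him1 him2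
  set W : ℝ → ℝ := fun y =>
    (airyA y).re * (deriv airyA y).im - (airyA y).im * (deriv airyA y).re with hW
  have hWd : ∀ y, HasDerivAt W 0 y := fun y =>
    (((hre1 y).mul (him2 y)).sub ((him1 y).mul (hre2 y))).congr_deriv (by ring)
  have hWc : ∀ y, W y = W 0 := fun y =>
    is_const_of_deriv_eq_zero (fun y => (hWd y).differentiableAt) (fun y => (hWd y).deriv) y 0
  -- With `x` and `y` the positive prefactors of `A(0)` and `A'(0)`, the value is `6√3 x y`.
  have hW0 : 0 < W 0 := by
    simp only [hW, hA.value_zero, hA.deriv_zero]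
    have g1 : 0 < Real.Gamma (1 / 3) * (6 : ℝ) ^ (-(2 / 3) : ℝ) :=
      mul_pos (Real.Gamma_pos_of_pos (by norm_num)) (by positivity)
    have g2 : 0 < Real.Gamma (2 / 3) * (6 : ℝ) ^ (-(1 / 3) : ℝ) :=
      mul_pos (Real.Gamma_pos_of_pos (by norm_num)) (by positivity)
    generalize Real.Gamma (1 / 3) * (6 : ℝ) ^ (-(2 / 3) : ℝ) = x at *
    generalize Real.Gamma (2 / 3) * (6 : ℝ) ^ (-(1 / 3) : ℝ) = y at *
    simp
    have : 0 < x * y * √3 := by positivity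
    nlinarith
  set C : ℝ := √(|K| + |L|) + 1 with hC
  have hC0 : 0 < C := by positivity
  have hCsq : K + L ≤ C ^ 2 := by
    have := Real.sq_sqrt (by positivity : 0 ≤ |K| + |L|)
    nlinarith [le_abs_self K, le_abs_self L, Real.sqrt_nonneg (|K| + |L|)]
  refine ⟨W 0 / C, C, by positivity, hC0, fun y s hy hs hsy => ?_⟩
  have hsq : √(1 + y) = s ^ 2 := by
    rw [← hsy, show s ^ 4 = (s ^ 2) ^ 2 by ring]; exact Real.sqrt_sq (by positivity)
  obtain ⟨k1, k2⟩ := hK y hy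
  obtain ⟨l1, l2⟩ := hL y hy
  rw [hsq] at k1 k2 l1 l2
  have nA : ‖airyA y‖ ^ 2 = (airyA y).re ^ 2 + (airyA y).im ^ 2 := by
    rw [← Complex.normSq_eq_norm_sq, Complex.normSq_apply]; ring
  have nD : ‖deriv airyA y‖ ^ 2 = (deriv airyA y).re ^ 2 + (deriv airyA y).im ^ 2 := by
    rw [← Complex.normSq_eq_norm_sq, Complex.normSq_apply]; ring
  have uA : ‖airyA y‖ ≤ C / s := by
    rw [le_div_iff₀ hs]
    refine le_of_abs_le (abs_le_of_sq_le_sq ?_ hC0.le)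
    rw [mul_pow, nA]; nlinarith
  have uD : ‖deriv airyA y‖ ≤ C * s := by
    refine le_of_abs_le (abs_le_of_sq_le_sq ?_ (by positivity))
    rw [mul_pow, nD]; nlinarith [sq_nonneg s]
  -- Lagrange's identity: `‖A‖² ‖A'‖²` is `W²` plus the square of the real inner product of `A` and
  -- `A'`.
  have hWle : W 0 ≤ ‖airyA y‖ * ‖deriv airyA y‖ := by
    rw [← hWc y]
    refine le_of_abs_le (abs_le_of_sq_le_sq ?_ (by positivity))
    rw [mul_pow, nA, nD]
    simp only [hW]
    nlinarith [sq_nonneg ((airyA y).re * (deriv airyA y).re + (airyA y).im * (deriv airyA y).im)]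
  refine ⟨?_, uA, ?_, uD⟩
  · rw [div_div, div_le_iff₀ (by positivity)]
    exact hWle.trans (by gcongr)
  · rw [div_mul_eq_mul_div, div_le_iff₀ hC0]
    calc W 0 * s ≤ ‖airyA y‖ * ‖deriv airyA y‖ * s := by gcongr
      _ ≤ C / s * ‖deriv airyA y‖ * s := by gcongr
      _ = _ := by field_simp

/-! ### Norms of `b` and its derivatives in terms of `A` and `A'` -/

/-- Writing `ν` and `β` as integer powers of new variables turns every fractional exponent into an
integer one, which makes the later estimates algebraic. -/
theorem pow_rpow_eq_zpow {p : ℝ} (hp : 0 < p) (k : ℕ) (m : ℤ) (e : ℝ) (h : k * e = m) :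
    (p ^ k) ^ e = p ^ m := by
  rw [← Real.rpow_natCast, ← Real.rpow_mul hp.le, h, Real.rpow_intCast]

theorem norm_airyB {n : ℝ} (hn : 0 < n) (β : ℝ) :
    ‖airyB (n ^ 3) β‖ = n⁻¹ * ‖airyA (1 / 2 * n ^ 2 * Real.tan β ^ 2)‖ := by
  have h1 := pow_rpow_eq_zpow hn 3 (-1) (-(1 / 3)) (by norm_num)
  have h2 := pow_rpow_eq_zpow hn 3 2 (2 / 3) (by norm_num)
  have h3 : ‖Complex.exp (-Complex.I * ((n ^ 3 : ℝ) : ℂ) * ((Real.tan β : ℝ) : ℂ) ^ 3 / 3)‖ = 1 := by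
    rw [show -Complex.I * ((n ^ 3 : ℝ) : ℂ) * ((Real.tan β : ℝ) : ℂ) ^ 3 / 3 =
      ((-(n ^ 3 * Real.tan β ^ 3 / 3) : ℝ) : ℂ) * Complex.I by push_cast; ring]
    exact Complex.norm_exp_ofReal_mul_I _
  rw [airyB, norm_mul, norm_mul, h3, h1, h2, Complex.norm_real, Real.norm_eq_abs,
    abs_of_pos (by positivity), one_mul, zpow_neg_one]
  norm_cast

/-- The three terms come from differentiating the phase, the factor `ν^(-1/3)` and the argument of
`A`. Each carries an exact coefficient `1/3`, which is dropped. -/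
theorem exists_hasDerivAt_airyB_left {n : ℝ} (hn : 0 < n) (β : ℝ) :
    ∃ D, HasDerivAt (fun s => airyB s β) D (n ^ 3) ∧
      ‖D‖ ≤ |Real.tan β| ^ 3 * n⁻¹ * ‖airyA (1 / 2 * n ^ 2 * Real.tan β ^ 2)‖
        + n⁻¹ ^ 4 * ‖airyA (1 / 2 * n ^ 2 * Real.tan β ^ 2)‖
        + n⁻¹ ^ 2 * Real.tan β ^ 2 * ‖deriv airyA (1 / 2 * n ^ 2 * Real.tan β ^ 2)‖ := by
  have h1 := pow_rpow_eq_zpow hn 3 (-1) (-(1 / 3)) (by norm_num)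
  have h2 := pow_rpow_eq_zpow hn 3 2 (2 / 3) (by norm_num)
  have h3 := pow_rpow_eq_zpow hn 3 (-4) (-(1 / 3) - 1) (by norm_num)
  have h4 := pow_rpow_eq_zpow hn 3 (-1) (2 / 3 - 1) (by norm_num)
  have hn3 : n ^ 3 ≠ 0 := by positivity
  set t := Real.tan β with ht
  have d1 : HasDerivAt (fun s : ℝ => Complex.exp (-Complex.I * (s : ℂ) * (t : ℂ) ^ 3 / 3))
      (Complex.exp (-Complex.I * ((n ^ 3 : ℝ) : ℂ) * (t : ℂ) ^ 3 / 3) *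
        (-Complex.I * 1 * (t : ℂ) ^ 3 / 3)) (n ^ 3) :=
    ((((hasDerivAt_id (n ^ 3)).ofReal_comp.const_mul (-Complex.I)).mul_const
      ((t : ℂ) ^ 3)).div_const 3).cexp
  have d2 := (Real.hasDerivAt_rpow_const (x := n ^ 3) (p := -(1 / 3)) (Or.inl hn3)).ofReal_comp
  have d3 := ((isAirySolution_airyA.differentiable
    (1 / 2 * (n ^ 3) ^ (2 / 3 : ℝ) * t ^ 2)).hasDerivAt).scomp (n ^ 3)
    (((Real.hasDerivAt_rpow_const (x := n ^ 3) (p := 2 / 3) (Or.inl hn3)).const_mul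
      (1 / 2)).mul_const (t ^ 2))
  have hE : ‖Complex.exp (-Complex.I * ((n ^ 3 : ℝ) : ℂ) * (t : ℂ) ^ 3 / 3)‖ = 1 := by
    rw [show -Complex.I * ((n ^ 3 : ℝ) : ℂ) * (t : ℂ) ^ 3 / 3 =
      ((-(n ^ 3 * t ^ 3 / 3) : ℝ) : ℂ) * Complex.I by push_cast; ring]
    exact Complex.norm_exp_ofReal_mul_I _
  refine ⟨_, (d1.mul d2).mul d3, ?_⟩
  simp only [h1, h2, h3, h4, Pi.mul_apply]
  have hz : n ^ (2 : ℤ) = n ^ 2 := by norm_cast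
  have hz4 : n ^ (-4 : ℤ) = n⁻¹ ^ 4 := by rw [zpow_neg, inv_pow]; norm_cast
  rw [hz, hz4, zpow_neg_one]
  generalize Complex.exp _ = E at *
  generalize airyA _ = a
  generalize deriv airyA _ = a'
  rw [add_mul]
  have hi : 0 < n⁻¹ := by positivity
  refine (norm_add₃_le).trans ?_
  simp only [norm_mul, norm_smul, norm_div, hE, Complex.norm_real, norm_neg, Complex.norm_I,
    norm_pow, Real.norm_eq_abs, norm_one, abs_of_pos hi, sq_abs]
  norm_num
  have x1 : 0 ≤ |t| ^ 3 * n⁻¹ * ‖a‖ := by positivity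
  have x2 : 0 ≤ (n ^ 4)⁻¹ * ‖a‖ := by positivity
  have x3 : 0 ≤ (n ^ 2)⁻¹ * t ^ 2 * ‖a'‖ := by positivity
  have e3 : n⁻¹ * (1 / 2 * (2 / 3 * n⁻¹) * t ^ 2 * ‖a'‖) = 1 / 3 * ((n ^ 2)⁻¹ * t ^ 2 * ‖a'‖) := by
    field_simp
  nlinarith

/-- The two terms come from the phase and the argument of `A`; the factor `1 + tan²β` is the
derivative of `tan`. -/
theorem exists_hasDerivAt_airyB_right {n : ℝ} (hn : 0 < n) {β : ℝ} (hβ : Real.cos β ≠ 0) :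
    ∃ D, HasDerivAt (fun s => airyB (n ^ 3) s) D β ∧
      ‖D‖ ≤ n ^ 2 * Real.tan β ^ 2 * (1 + Real.tan β ^ 2) *
          ‖airyA (1 / 2 * n ^ 2 * Real.tan β ^ 2)‖
        + n * |Real.tan β| * (1 + Real.tan β ^ 2) *
          ‖deriv airyA (1 / 2 * n ^ 2 * Real.tan β ^ 2)‖ := by
  have h1 := pow_rpow_eq_zpow hn 3 (-1) (-(1 / 3)) (by norm_num)
  have h2 := pow_rpow_eq_zpow hn 3 2 (2 / 3) (by norm_num)
  have ht := Real.hasDerivAt_tan hβ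
  have hsec : 1 / Real.cos β ^ 2 = 1 + Real.tan β ^ 2 := by
    rw [← Real.inv_one_add_tan_sq hβ, one_div, inv_inv]
  rw [hsec] at ht
  have d1 := ((((ht.ofReal_comp).pow 3).const_mul
    (-Complex.I * ((n ^ 3 : ℝ) : ℂ))).div_const 3).cexp
  have d2 := ((isAirySolution_airyA.differentiable
    (1 / 2 * (n ^ 3) ^ (2 / 3 : ℝ) * Real.tan β ^ 2)).hasDerivAt).scomp β
    ((ht.pow 2).const_mul (1 / 2 * (n ^ 3) ^ (2 / 3 : ℝ)))
  have hE : ‖Complex.exp (-Complex.I * ((n ^ 3 : ℝ) : ℂ) * ((Real.tan β : ℝ) : ℂ) ^ 3 / 3)‖ = 1 := by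
    rw [show -Complex.I * ((n ^ 3 : ℝ) : ℂ) * ((Real.tan β : ℝ) : ℂ) ^ 3 / 3 =
      ((-(n ^ 3 * Real.tan β ^ 3 / 3) : ℝ) : ℂ) * Complex.I by push_cast; ring]
    exact Complex.norm_exp_ofReal_mul_I _
  refine ⟨_, (d1.mul_const (((n ^ 3) ^ (-(1 / 3) : ℝ) : ℝ) : ℂ)).mul d2, ?_⟩
  simp only [h1, h2, Pi.pow_apply]
  have hz : n ^ (2 : ℤ) = n ^ 2 := by norm_cast
  rw [hz, zpow_neg_one]
  generalize Complex.exp _ = E at *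
  generalize airyA _ = a
  generalize deriv airyA _ = a'
  generalize Real.tan β = t at *
  have hi : 0 < n⁻¹ := by positivity
  have hp : 0 < 1 + t ^ 2 := by positivity
  refine (norm_add_le _ _).trans (le_of_eq ?_)
  simp only [norm_mul, norm_smul, norm_div, hE, Complex.norm_real, norm_neg, Complex.norm_I,
    norm_pow, Real.norm_eq_abs, norm_one, abs_of_pos hi,
    abs_of_pos hp, abs_of_pos hn]
  norm_num
  field_simp

/-! ### Estimates in the two angular regimes -/

theorem tan_bounds {β : ℝ} (h0 : 0 ≤ β) (h1 : β ≤ Real.pi / 4) :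
    Real.cos β ≠ 0 ∧ β ≤ Real.tan β ∧ Real.tan β ≤ 2 * β ∧ Real.tan β ≤ 2 := by
  have hπ := Real.pi_pos
  have hπ4 := Real.pi_le_four
  have hcos : 1 / 2 ≤ Real.cos β := by
    rw [← Real.cos_pi_div_three]
    exact Real.cos_le_cos_of_nonneg_of_le_pi h0 (by linarith) (by linarith)
  have ht : Real.tan β ≤ 2 * β := by
    rw [Real.tan_eq_sin_div_cos, div_le_iff₀ (by linarith)]
    nlinarith [Real.sin_le h0]
  exact ⟨by linarith, Real.le_tan h0 (by linarith), ht, by linarith⟩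

/-- The bounds for `b` and its derivatives in the range `β ≤ 1 / n`, where `ν = n ^ 3`. -/
theorem small_angle_bounds {c C n β t s a a' : ℝ} (hc : 0 < c) (hC : 0 < C) (hn : 0 < n)
    (hβ : 0 ≤ β) (hβn : β ≤ n⁻¹) (h1 : β ≤ t) (h2 : t ≤ 2 * β) (h3 : t ≤ 2) (hs : 0 < s)
    (hs4 : s ^ 4 = 1 + 1 / 2 * n ^ 2 * t ^ 2) (ha0 : 0 ≤ a) (ha0' : 0 ≤ a')
    (hca : c / s ≤ a)
    (haC : a ≤ C / s) (haC' : a' ≤ C * s) :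
    c / 2 * n⁻¹ ≤ n⁻¹ * a ∧ n⁻¹ * a ≤ 100 * C * n⁻¹ ∧
      |t| ^ 3 * n⁻¹ * a + n⁻¹ ^ 4 * a + n⁻¹ ^ 2 * t ^ 2 * a' ≤ 100 * C * n⁻¹ ^ 4 ∧
      n ^ 2 * t ^ 2 * (1 + t ^ 2) * a + n * |t| * (1 + t ^ 2) * a' ≤ 100 * C * (n * β) := by
  have ht0 : 0 ≤ t := hβ.trans h1
  rw [abs_of_nonneg ht0]
  have hi : 0 < n⁻¹ := by positivity
  have hnt : n * t ≤ 2 := by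
    have : n * β ≤ 1 := by
      calc n * β ≤ n * n⁻¹ := by gcongr
        _ = 1 := by field_simp
    nlinarith
  have hti : t ≤ 2 * n⁻¹ := by linarith
  have hs1 : 1 ≤ s := by
    by_contra! h
    have : s ^ 4 < 1 := pow_lt_one₀ hs.le h (by norm_num)
    have : 0 ≤ 1 / 2 * n ^ 2 * t ^ 2 := by positivity
    linarith
  -- Here `nt ≤ 2`, so `s⁴ ≤ 3`: both `A` and `A'` have size comparable to a constant.
  have hs2 : s ≤ 2 := by
    refine (pow_le_pow_iff_left₀ hs.le (by norm_num) (by norm_num : 4 ≠ 0)).1 ?_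
    have : (n * t) ^ 2 ≤ 2 ^ 2 := by gcongr
    nlinarith
  have hA : a ≤ C := haC.trans (div_le_self hC.le hs1)
  have hA' : a' ≤ 2 * C := by nlinarith
  have hA2 : c / 2 ≤ a := le_trans (by gcongr) hca
  have ht2 : 1 + t ^ 2 ≤ 5 := by nlinarith
  refine ⟨by nlinarith, by nlinarith [mul_pos hC hi], ?_, ?_⟩
  · have e1 : t ^ 3 * n⁻¹ * a ≤ (2 * n⁻¹) ^ 3 * n⁻¹ * C := by gcongr
    have e2 : n⁻¹ ^ 4 * a ≤ n⁻¹ ^ 4 * C := by gcongr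
    have e3 : n⁻¹ ^ 2 * t ^ 2 * a' ≤ n⁻¹ ^ 2 * (2 * n⁻¹) ^ 2 * (2 * C) := by gcongr
    have e4 : 0 < C * n⁻¹ ^ 4 := by positivity
    nlinarith
  · have e1 : n ^ 2 * t ^ 2 * (1 + t ^ 2) * a ≤ 2 * (n * (2 * β)) * 5 * C := by
      rw [show n ^ 2 * t ^ 2 = (n * t) * (n * t) by ring]
      gcongr
    have e2 : n * t * (1 + t ^ 2) * a' ≤ n * (2 * β) * 5 * (2 * C) := by gcongr
    have e3 : 0 ≤ C * (n * β) := by positivity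
    nlinarith

/-- The bounds for `b` and its derivatives in the range `β ≥ ν ^ (-1 / 3)`, where `ν = p ^ 6` and
`β = q ^ 2`. -/
theorem large_angle_bounds {c C p q t s a a' : ℝ} (hc : 0 < c) (hC : 0 < C) (hp : 0 < p)
    (hq : 0 < q) (hpq : 1 ≤ p * q) (h1 : q ^ 2 ≤ t) (h2 : t ≤ 2 * q ^ 2) (h3 : t ≤ 2) (hs : 0 < s)
    (hs4 : s ^ 4 = 1 + 1 / 2 * (p ^ 2) ^ 2 * t ^ 2) (ha0 : 0 ≤ a) (ha0' : 0 ≤ a')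
    (hca : c / s ≤ a)
    (haC : a ≤ C / s) (haC' : a' ≤ C * s) :
    c / 2 * (p⁻¹ ^ 3 * q⁻¹) ≤ (p ^ 2)⁻¹ * a ∧ (p ^ 2)⁻¹ * a ≤ 100 * C * (p⁻¹ ^ 3 * q⁻¹) ∧
      |t| ^ 3 * (p ^ 2)⁻¹ * a + (p ^ 2)⁻¹ ^ 4 * a + (p ^ 2)⁻¹ ^ 2 * t ^ 2 * a' ≤
        100 * C * (p⁻¹ ^ 3 * q ^ 5) ∧
      (p ^ 2) ^ 2 * t ^ 2 * (1 + t ^ 2) * a + p ^ 2 * |t| * (1 + t ^ 2) * a' ≤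
        100 * C * (p ^ 3 * q ^ 3) := by
  have ht0 : 0 ≤ t := le_trans (by positivity) h1
  rw [abs_of_nonneg ht0]
  have hm : 0 < p * q := by positivity
  have hm4 : 1 ≤ (p * q) ^ 4 := one_le_pow₀ hpq
  -- Since `pq ≥ 1`, the `1` in `s⁴` is absorbed, and `s` lies between `pq/2` and `2pq`.
  have hs2 : s ≤ 2 * (p * q) := by
    refine (pow_le_pow_iff_left₀ hs.le (by positivity) (by norm_num : 4 ≠ 0)).1 ?_
    have : (p ^ 2) ^ 2 * t ^ 2 ≤ (p ^ 2) ^ 2 * (2 * q ^ 2) ^ 2 := by gcongr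
    nlinarith
  have hs1 : p * q / 2 ≤ s := by
    refine (pow_le_pow_iff_left₀ (by positivity) hs.le (by norm_num : 4 ≠ 0)).1 ?_
    have : (p ^ 2) ^ 2 * (q ^ 2) ^ 2 ≤ (p ^ 2) ^ 2 * t ^ 2 := by gcongr
    nlinarith
  have hA : a ≤ 2 * C / (p * q) := by
    refine haC.trans ?_
    rw [div_le_div_iff₀ hs hm]
    nlinarith
  have hA' : a' ≤ 2 * C * (p * q) := by nlinarith
  have hA2 : c / (2 * (p * q)) ≤ a := le_trans (by gcongr) hca
  have ht2 : 1 + t ^ 2 ≤ 5 := by nlinarith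
  refine ⟨?_, ?_, ?_, ?_⟩
  · calc c / 2 * (p⁻¹ ^ 3 * q⁻¹) = (p ^ 2)⁻¹ * (c / (2 * (p * q))) := by field_simp
      _ ≤ _ := by gcongr
  · calc (p ^ 2)⁻¹ * a ≤ (p ^ 2)⁻¹ * (2 * C / (p * q)) := by gcongr
      _ = 2 * C * (p⁻¹ ^ 3 * q⁻¹) := by field_simp
      _ ≤ _ := by gcongr; norm_num
  · have e1 : t ^ 3 * (p ^ 2)⁻¹ * a ≤ (2 * q ^ 2) ^ 3 * (p ^ 2)⁻¹ * (2 * C / (p * q)) := by gcongr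
    -- This term is smaller than the other two; inserting `(pq)⁶ ≥ 1` brings it to the common order
    -- `p⁻³q⁵`.
    have e2 : (p ^ 2)⁻¹ ^ 4 * a ≤ (p * q) ^ 6 * ((p ^ 2)⁻¹ ^ 4 * (2 * C / (p * q))) := by
      refine le_trans (by gcongr) (le_mul_of_one_le_left (by positivity) (one_le_pow₀ hpq))
    have e3 : (p ^ 2)⁻¹ ^ 2 * t ^ 2 * a' ≤ (p ^ 2)⁻¹ ^ 2 * (2 * q ^ 2) ^ 2 * (2 * C * (p * q)) := by
      gcongr
    have f1 : (2 * q ^ 2) ^ 3 * (p ^ 2)⁻¹ * (2 * C / (p * q)) = 16 * (C * (p⁻¹ ^ 3 * q ^ 5)) := by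
      field_simp; norm_num
    have f2 : (p * q) ^ 6 * ((p ^ 2)⁻¹ ^ 4 * (2 * C / (p * q))) = 2 * (C * (p⁻¹ ^ 3 * q ^ 5)) := by
      field_simp
    have f3 : (p ^ 2)⁻¹ ^ 2 * (2 * q ^ 2) ^ 2 * (2 * C * (p * q)) = 8 * (C * (p⁻¹ ^ 3 * q ^ 5)) := by
      field_simp; norm_num
    have f4 : 0 < C * (p⁻¹ ^ 3 * q ^ 5) := by positivity
    linarith
  · have e1 : (p ^ 2) ^ 2 * t ^ 2 * (1 + t ^ 2) * a ≤
        (p ^ 2) ^ 2 * (2 * q ^ 2) ^ 2 * 5 * (2 * C / (p * q)) := by gcongr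
    have e2 : p ^ 2 * t * (1 + t ^ 2) * a' ≤ p ^ 2 * (2 * q ^ 2) * 5 * (2 * C * (p * q)) := by gcongr
    have f1 : (p ^ 2) ^ 2 * (2 * q ^ 2) ^ 2 * 5 * (2 * C / (p * q)) = 40 * (C * (p ^ 3 * q ^ 3)) := by
      field_simp; norm_num
    have f4 : 0 < C * (p ^ 3 * q ^ 3) := by positivity
    nlinarith

/-! ### Assembly -/

theorem proposition4p12 :
    ∃ c C : ℝ, 0 < c ∧ 0 < C ∧
      -- two-sided bounds for `A` and its derivative on the half-line
      (∀ y : ℝ, 0 ≤ y →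
        (c * (1 + y) ^ (-(1 / 4) : ℝ) ≤ ‖airyA y‖ ∧
          ‖airyA y‖ ≤ C * (1 + y) ^ (-(1 / 4) : ℝ)) ∧
        (c * (1 + y) ^ ((1 / 4) : ℝ) ≤ ‖deriv airyA y‖ ∧
          ‖deriv airyA y‖ ≤ C * (1 + y) ^ ((1 / 4) : ℝ))) ∧
      -- the bounds for `b` and its first derivatives
      (∀ ν β : ℝ, 1 / 2 ≤ ν → 0 ≤ β → β ≤ Real.pi / 4 →
        DifferentiableAt ℝ (fun s : ℝ => airyB s β) ν ∧
        DifferentiableAt ℝ (fun s : ℝ => airyB ν s) β ∧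
        (β ≤ ν ^ (-(1 / 3) : ℝ) →
          (c * ν ^ (-(1 / 3) : ℝ) ≤ ‖airyB ν β‖ ∧
            ‖airyB ν β‖ ≤ C * ν ^ (-(1 / 3) : ℝ)) ∧
          ‖deriv (fun s : ℝ => airyB s β) ν‖ ≤ C * ν ^ (-(4 / 3) : ℝ) ∧
          ‖deriv (fun s : ℝ => airyB ν s) β‖ ≤ C * (ν ^ ((1 / 3) : ℝ) * β)) ∧
        (ν ^ (-(1 / 3) : ℝ) ≤ β →
          (c * (ν ^ (-(1 / 2) : ℝ) * β ^ (-(1 / 2) : ℝ)) ≤ ‖airyB ν β‖ ∧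
            ‖airyB ν β‖ ≤ C * (ν ^ (-(1 / 2) : ℝ) * β ^ (-(1 / 2) : ℝ))) ∧
          ‖deriv (fun s : ℝ => airyB s β) ν‖ ≤
            C * (ν ^ (-(1 / 2) : ℝ) * β ^ ((5 / 2) : ℝ)) ∧
          ‖deriv (fun s : ℝ => airyB ν s) β‖ ≤
            C * (ν ^ ((1 / 2) : ℝ) * β ^ ((3 / 2) : ℝ)))) := by
  obtain ⟨c, C, hc, hC, h⟩ := exists_airyA_bounds
  -- The loss `1/2` comes from `s ≤ 2` or `s ≤ 2pq`. The largest upper constant arising is `60C`,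
  -- from `∂_β b` at large angles.
  refine ⟨c / 2, 100 * C, by positivity, by positivity, fun y hy => ?_, fun ν β hν hβ hβ' => ?_⟩
  · have hs : 0 < (1 + y) ^ (1 / 4 : ℝ) := by positivity
    obtain ⟨h1, h2, h3, h4⟩ := h y ((1 + y) ^ (1 / 4 : ℝ)) hy hs (by
      rw [← Real.rpow_natCast, ← Real.rpow_mul (by linarith)]; norm_num)
    rw [Real.rpow_neg (by linarith), ← div_eq_mul_inv, ← div_eq_mul_inv]
    exact ⟨⟨le_trans (by gcongr; linarith) h1, h2.trans (by gcongr; linarith)⟩,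
      le_trans (by gcongr; linarith) h3, h4.trans (by gcongr; linarith)⟩
  · obtain ⟨hcos, ht1, ht2, ht3⟩ := tan_bounds hβ hβ'
    -- A sixth root of `ν` serves the exponents in thirds and in halves at once; `n` becomes `p²`.
    obtain ⟨p, hp, rfl⟩ : ∃ p : ℝ, 0 < p ∧ p ^ 6 = ν :=
      ⟨ν ^ (1 / 6 : ℝ), by positivity, by
        rw [← Real.rpow_natCast, ← Real.rpow_mul (by linarith)]; norm_num⟩
    have hn : 0 < p ^ 2 := by positivity
    have r := pow_rpow_eq_zpow hp 6
    have r1 : (p ^ 6) ^ (-(1 / 3) : ℝ) = (p ^ 2)⁻¹ := r (-2) _ (by norm_num)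
    have r2 : (p ^ 6) ^ (-(4 / 3) : ℝ) = (p ^ 2)⁻¹ ^ 4 :=
      (r (-8) _ (by norm_num)).trans (by rw [zpow_neg, inv_pow, ← pow_mul]; norm_cast)
    have r3 : (p ^ 6) ^ (1 / 3 : ℝ) = p ^ 2 := r 2 _ (by norm_num)
    have r4 : (p ^ 6) ^ (-(1 / 2) : ℝ) = p⁻¹ ^ 3 :=
      (r (-3) _ (by norm_num)).trans (by rw [zpow_neg, inv_pow]; norm_cast)
    have r5 : (p ^ 6) ^ (1 / 2 : ℝ) = p ^ 3 := r 3 _ (by norm_num)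
    obtain ⟨D, hD, hDn⟩ := exists_hasDerivAt_airyB_left hn β
    obtain ⟨F, hF, hFn⟩ := exists_hasDerivAt_airyB_right hn hcos
    have hb := norm_airyB hn β
    have hp6 : (p ^ 2) ^ 3 = p ^ 6 := by ring
    rw [hp6] at hb hD
    simp only [hp6] at hF
    have hy : 0 ≤ 1 / 2 * (p ^ 2) ^ 2 * Real.tan β ^ 2 := by positivity
    set y := 1 / 2 * (p ^ 2) ^ 2 * Real.tan β ^ 2 with hy_def
    have hs : 0 < (1 + y) ^ (1 / 4 : ℝ) := by positivity
    have hs4 : ((1 + y) ^ (1 / 4 : ℝ)) ^ 4 = 1 + y := by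
      rw [← Real.rpow_natCast, ← Real.rpow_mul (by linarith)]; norm_num
    obtain ⟨h1, h2, -, h4⟩ := h y _ hy hs hs4
    rw [hD.deriv, hF.deriv, hb, r1, r2, r3, r4, r5]
    refine ⟨hD.differentiableAt, hF.differentiableAt, fun hle => ?_, fun hle => ?_⟩
    · obtain ⟨b1, b2, b3, b4⟩ := small_angle_bounds hc hC hn hβ hle ht1 ht2 ht3 hs hs4
        (norm_nonneg _) (norm_nonneg _) h1 h2 h4
      exact ⟨⟨b1, b2⟩, hDn.trans b3, hFn.trans b4⟩
    · have hβ0 : 0 < β := lt_of_lt_of_le (by positivity) hle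
      obtain ⟨q, hq, rfl⟩ : ∃ q : ℝ, 0 < q ∧ q ^ 2 = β :=
        ⟨√β, Real.sqrt_pos.2 hβ0, Real.sq_sqrt hβ⟩
      have hpq : 1 ≤ p * q := by
        rw [← inv_pow] at hle
        have := (pow_le_pow_iff_left₀ (by positivity) hq.le two_ne_zero).1 hle
        rwa [inv_le_iff_one_le_mul₀' hp] at this
      have k := pow_rpow_eq_zpow hq 2
      have k1 : (q ^ 2) ^ (-(1 / 2) : ℝ) = q⁻¹ :=
        (k (-1) _ (by norm_num)).trans (zpow_neg_one q)
      have k2 : (q ^ 2) ^ (5 / 2 : ℝ) = q ^ 5 := k 5 _ (by norm_num)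
      have k3 : (q ^ 2) ^ (3 / 2 : ℝ) = q ^ 3 := k 3 _ (by norm_num)
      rw [k1, k2, k3]
      obtain ⟨b1, b2, b3, b4⟩ := large_angle_bounds hc hC hp hq hpq ht1 ht2 ht3 hs hs4
        (norm_nonneg _) (norm_nonneg _) h1 h2 h4
      exact ⟨⟨b1, b2⟩, hDn.trans b3, hFn.trans b4⟩
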